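/- Let $H$ be a (possibly unbounded) self-adjoint operator in a complex Hilbert space $\mathfrak H$, and let $P_0\neq 0$ be an orthogonal projection in $\mathfrak H$, with range $\mathfrak P_0$, such that $P_0\,\mathrm{Dom}(H)\subset\mathrm{Dom}(H)$. Assume that the commutator $[H,P_0]$ is bounded on $\mathrm{Dom}(H)$, that is, $$V_{H,P_0}:=\sup\{\|HP_0f-P_0Hf\| : f\in\mathrm{Dom}(H),\ \|f\|=1\}<\infty .$$ For $t\in\mathbb R$ let $\mathfrak P_t$ be the range of $e^{-\mathrm iHt}P_0$ (equivalently, of the orthogonal projection $P_t=e^{-\mathrm iHt}P_0e^{\mathrm iHt}$). For closed subspaces $\mathfrak Q,\mathfrak R$ of $\mathfrak H$ with orthogonal projections $Q,R$, let $\vartheta(\mathfrak Q,\mathfrak R):=\arcsin\|Q-R\|$ be the maximal angle between them. Let $0<\theta\le\pi/2$. If $V_{H,P_0}>0$, then every time $T_\theta\ge 0$ with $\vartheta(\mathfrak P_0,\mathfrak P_{T_\theta})=\theta$ satisfies $$T_\theta\ \ge\ \frac{\theta}{V_{H,P_0}} .$$ If $V_{H,P_0}=0$, then $\vartheta(\mathfrak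 P_0,\mathfrak P_t)\neq\theta$ for all $t\ge 0$, i.e. $T_\theta=\infty$. -/

import Mathlib

open scoped ENNReal InnerProductSpace

/-- `U` is the strongly continuous one-parameter unitary group on `𝓗` whose infinitesimal
generator is exactly `-i H`: a vector `f` lies in `Dom H` and `H f = g` if and only if
`t ↦ U t f` is differentiable at `0` with derivative `-i g`. -/
structure IsUnitaryGroupGeneratedBy {𝓗 : Type*} [NormedAddCommGroup 𝓗] [InnerProductSpace ℂ 𝓗]
    (H : 𝓗 →ₗ.[ℂ] 𝓗) (U : ℝ → (𝓗 ≃ₗᵢ[ℂ] 𝓗)) : Prop where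
  map_add : ∀ (s t : ℝ) (f : 𝓗), U (s + t) f = U s (U t f)
  continuous_apply : ∀ f : 𝓗, Continuous (fun t : ℝ => U t f)
  mem_graph_iff : ∀ f g : 𝓗,
    (f, g) ∈ H.graph ↔ HasDerivAt (fun t : ℝ => U t f) (-(Complex.I • g)) 0

/-- The propagator `U(t) = exp (-i H t)`: the unitary group generated by `-i H`. For a self-adjoint
`H` this group exists and is unique (Stone); for other `H` the value is irrelevant. -/
noncomputable def unitaryGroup {𝓗 : Type*} [NormedAddCommGroup 𝓗] [InnerProductSpace ℂ 𝓗]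
    (H : 𝓗 →ₗ.[ℂ] 𝓗) : ℝ → (𝓗 ≃ₗᵢ[ℂ] 𝓗) :=
  Classical.epsilon (IsUnitaryGroupGeneratedBy H)

/-- The subspace path `𝔓_t = Ran (exp (-i H t)|_{𝔓₀}) = exp (-i H t) 𝔓₀`. -/
noncomputable def evolvedSubspace {𝓗 : Type*} [NormedAddCommGroup 𝓗] [InnerProductSpace ℂ 𝓗]
    (H : 𝓗 →ₗ.[ℂ] 𝓗) (𝔓₀ : Submodule ℂ 𝓗) (t : ℝ) : Submodule ℂ 𝓗 :=
  𝔓₀.map ((unitaryGroup H t).toLinearEquiv : 𝓗 →ₗ[ℂ] 𝓗)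

/-- The unitary image of a subspace with an orthogonal projection has an orthogonal projection. -/
instance evolvedSubspace.instHasOrthogonalProjection {𝓗 : Type*} [NormedAddCommGroup 𝓗]
    [InnerProductSpace ℂ 𝓗] (H : 𝓗 →ₗ.[ℂ] 𝓗) (𝔓₀ : Submodule ℂ 𝓗)
    [𝔓₀.HasOrthogonalProjection] (t : ℝ) :
    (evolvedSubspace H 𝔓₀ t).HasOrthogonalProjection :=
  inferInstanceAs
    (𝔓₀.map ((unitaryGroup H t).toLinearEquiv : 𝓗 →ₗ[ℂ] 𝓗)).HasOrthogonalProjection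

/-- The maximal angle `ϑ(𝔔, ℜ) = arcsin ‖Q - R‖` between two closed subspaces, where `Q` and `R`
are the orthogonal projections onto them. -/
noncomputable def maximalAngle {𝓗 : Type*} [NormedAddCommGroup 𝓗] [InnerProductSpace ℂ 𝓗]
    (𝔔 ℜ : Submodule ℂ 𝓗) [𝔔.HasOrthogonalProjection] [ℜ.HasOrthogonalProjection] : ℝ :=
  Real.arcsin ‖𝔔.starProjection - ℜ.starProjection‖

/-- The norm `V_{H,P} = sup ‖H P f - P H f‖ ∈ [0, ∞]` of the commutator `[H, P]`, the supremum being
over the unit vectors `f` in `Dom [H, P] = {f ∈ Dom H | P f ∈ Dom H}`. -/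
noncomputable def commutatorNorm {𝓗 : Type*} [NormedAddCommGroup 𝓗] [InnerProductSpace ℂ 𝓗]
    (H : 𝓗 →ₗ.[ℂ] 𝓗) (P : 𝓗 →L[ℂ] 𝓗) : ℝ≥0∞ :=
  ⨆ (f : H.domain) (hPf : P (f : 𝓗) ∈ H.domain) (_ : ‖(f : 𝓗)‖ = 1),
    ‖H ⟨P (f : 𝓗), hPf⟩ - P (H f)‖ₑ

/-! Write `P` for the projection onto `𝔓₀`, `V` for the norm of the commutator and `U t` for the
propagator. The whole statement follows from `ϑ(𝔓₀, 𝔓_t) ≤ V * |t|`. For a unit vector `f ∈ 𝔓₀ ∩ Dom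
H`, put `‖P (U s f)‖ = cos φ(s)`. The diagonal part `⟪P x, H P x⟫` is real, so only the off-diagonal
block of `H` changes `φ`. That block is a block of the commutator, hence bounded by `V`
(`abs_re_inner_starProjection_le`), which says formally that `|φ'| ≤ V`. A comparison argument
(`Real.cos_mul_le_of_abs_deriv_le`) makes this rigorous and gives `‖(1 - P) U t f‖ ≤ sin (V * |t|)`
while `V * |t| < π / 2`. Density extends the bound to all of `𝔓₀`. The bounds at `t` and at `-t`
together control the norm of the difference of the projections (`norm_starProjection_sub_map_le`).
Since `unitaryGroup` is a choice, its defining properties rest on the existence half of Stone's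
theorem. This is proved by approximating `H` with the bounded operators `H (1 + c² H²)⁻¹` as `c →
0`. -/

/-- The unitary group `exp (-i A t)` of a bounded operator `A`. -/
noncomputable def boundedPropagator {𝓗 : Type*} [NormedAddCommGroup 𝓗] [InnerProductSpace ℂ 𝓗]
    [CompleteSpace 𝓗] (A : 𝓗 →L[ℂ] 𝓗) (t : ℝ) : 𝓗 →L[ℂ] 𝓗 :=
  NormedSpace.exp (t • (-(Complex.I • A)))

/-! ### Unitary groups with bounded generator -/

namespace boundedPropagator

variable {𝓗 : Type*} [NormedAddCommGroup 𝓗] [InnerProductSpace ℂ 𝓗] [CompleteSpace 𝓗]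
  {A B : 𝓗 →L[ℂ] 𝓗}

theorem zero_apply (A : 𝓗 →L[ℂ] 𝓗) (x : 𝓗) : boundedPropagator A 0 x = x := by
  simp [boundedPropagator]

theorem add_apply (A : 𝓗 →L[ℂ] 𝓗) (s t : ℝ) (x : 𝓗) :
    boundedPropagator A (s + t) x = boundedPropagator A s (boundedPropagator A t x) := by
  have h : Commute (s • (-(Complex.I • A))) (t • (-(Complex.I • A))) :=
    ((Commute.refl _).smul_left s).smul_right t
  let _ : NormedAlgebra ℚ (𝓗 →L[ℂ] 𝓗) := NormedAlgebra.restrictScalars ℚ ℂ _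
  rw [boundedPropagator, add_smul, NormedSpace.exp_add_of_commute h]
  rfl

theorem norm_apply (hA : IsSelfAdjoint A) (t : ℝ) (x : 𝓗) :
    ‖boundedPropagator A t x‖ = ‖x‖ := by
  refine ContinuousLinearMap.norm_map_of_mem_unitary ?_ x
  let _ : NormedAlgebra ℚ (𝓗 →L[ℂ] 𝓗) := NormedAlgebra.restrictScalars ℚ ℂ _
  refine NormedSpace.exp_mem_unitary_of_mem_skewAdjoint ?_
  rw [skewAdjoint.mem_iff, star_smul, star_neg, star_smul, hA.star_eq]
  simp

theorem hasDerivAt (A : 𝓗 →L[ℂ] 𝓗) (x : 𝓗) (t : ℝ) :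
    HasDerivAt (fun s => boundedPropagator A s x)
      (boundedPropagator A t (-(Complex.I • A x))) t := by
  have h := hasDerivAt_exp_smul_const (𝕂 := ℝ) (-(Complex.I • A)) t
  have h2 := (((ContinuousLinearMap.apply ℂ 𝓗 x).restrictScalars ℝ).hasFDerivAt).comp_hasDerivAt t h
  simpa [boundedPropagator, Function.comp_def] using h2

theorem norm_apply_sub_self_le (hA : IsSelfAdjoint A) (t : ℝ) (x : 𝓗) :
    ‖boundedPropagator A t x - x‖ ≤ |t| * ‖A x‖ := by
  have := convex_univ.norm_image_sub_le_of_norm_hasDerivWithin_le (C := ‖A x‖)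
    (f := fun s : ℝ => boundedPropagator A s x)
    (fun s _ => (hasDerivAt A x s).hasDerivWithinAt)
    (fun s _ => by simp [norm_apply hA, norm_smul]) (Set.mem_univ 0) (Set.mem_univ t)
  simpa [zero_apply, mul_comm] using this

/-- Commuting exponents give `exp (-i A t) = exp (-i B t) exp (-i (A - B) t)`, and the first factor
is isometric. The bound involves only `A x - B x`, not `‖A - B‖`, so it suits generators that
converge only strongly. -/
theorem norm_apply_sub_apply_le (hA : IsSelfAdjoint A) (hB : IsSelfAdjoint B) (h : Commute A B)
    (t : ℝ) (x : 𝓗) :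
    ‖boundedPropagator A t x - boundedPropagator B t x‖ ≤ |t| * ‖A x - B x‖ := by
  have key : boundedPropagator A t x = boundedPropagator B t (boundedPropagator (A - B) t x) := by
    have hc : Commute (t • (-(Complex.I • B))) (t • (-(Complex.I • (A - B)))) := by
      refine ((Commute.neg_left (Commute.neg_right ?_)).smul_left t).smul_right t
      exact ((h.symm.sub_right (Commute.refl B)).smul_left _).smul_right _
    let _ : NormedAlgebra ℚ (𝓗 →L[ℂ] 𝓗) := NormedAlgebra.restrictScalars ℚ ℂ _
    have := NormedSpace.exp_add_of_commute hc
    rw [← smul_add, ← neg_add, ← smul_add, add_sub_cancel] at this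
    rw [boundedPropagator, this]
    rfl
  rw [key, ← map_sub, norm_apply hB]
  simpa using norm_apply_sub_self_le (hA.sub hB) t x

theorem norm_apply_sub_self_add_le (A : 𝓗 →L[ℂ] 𝓗) (t : ℝ) (x : 𝓗) {C : ℝ}
    (hC : ∀ s : ℝ, |s| ≤ |t| → ‖boundedPropagator A s (A x) - A x‖ ≤ C) :
    ‖boundedPropagator A t x - x + t • (Complex.I • A x)‖ ≤ C * |t| := by
  have hd : ∀ s : ℝ, HasDerivAt (fun s => boundedPropagator A s x + s • (Complex.I • A x))
      (-(Complex.I • (boundedPropagator A s (A x) - A x))) s := by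
    intro s
    convert (hasDerivAt A x s).add ((hasDerivAt_id s).smul_const (Complex.I • A x)) using 1
    · rfl
    · rw [one_smul, smul_sub, map_neg, map_smul]
      abel
  have := (convex_uIcc (0 : ℝ) t).norm_image_sub_le_of_norm_hasDerivWithin_le (C := C)
    (fun s _ => (hd s).hasDerivWithinAt)
    (fun s hs => by
      rw [norm_neg, norm_smul, Complex.norm_I, one_mul]
      exact hC s (by simpa using Set.abs_sub_left_of_mem_uIcc hs))
    Set.left_mem_uIcc Set.right_mem_uIcc
  simp only [zero_apply, zero_smul, add_zero, sub_zero, Real.norm_eq_abs] at this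
  convert this using 2
  abel

end boundedPropagator

/-! ### Resolvents of a self-adjoint operator and bounded approximations -/

section Resolvent

open Filter Topology

variable {𝓗 : Type*} [NormedAddCommGroup 𝓗] [InnerProductSpace ℂ 𝓗] [CompleteSpace 𝓗]
  {H : 𝓗 →ₗ.[ℂ] 𝓗}

theorem IsSelfAdjoint.mem_graph_iff_inner (hH : IsSelfAdjoint H) (x y : 𝓗) :
    (x, y) ∈ H.graph ↔ ∀ a b : 𝓗, (a, b) ∈ H.graph → ⟪b, x⟫_ℂ = ⟪a, y⟫_ℂ := by
  have h := LinearPMap.adjoint_graph_eq_graph_adjoint hH.dense_domain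
  rw [LinearPMap.isSelfAdjoint_def.mp hH] at h
  rw [h, Submodule.mem_adjoint_iff, ← h]
  simp only [sub_eq_zero]

/-- The cross term vanishes because `⟪x, H x⟫` is real. This identity yields injectivity, closed
range and contractivity for `(1 + i c H)⁻¹`. -/
theorem IsSelfAdjoint.norm_add_smul_sq (hH : IsSelfAdjoint H) {x y : 𝓗} (h : (x, y) ∈ H.graph)
    (c : ℝ) : ‖x + (Complex.I * c) • y‖ ^ 2 = ‖x‖ ^ 2 + c ^ 2 * ‖y‖ ^ 2 := by
  have h1 : (⟪x, y⟫_ℂ).im = 0 := by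
    have h2 := (hH.mem_graph_iff_inner x y).mp h x y h
    rw [← inner_conj_symm] at h2
    exact Complex.conj_eq_iff_im.mp h2
  rw [norm_add_sq (𝕜 := ℂ), inner_smul_right, norm_smul, mul_pow]
  simp [h1]

theorem IsSelfAdjoint.exists_add_smul_eq (hH : IsSelfAdjoint H) {c : ℝ} (hc : c ≠ 0) (h : 𝓗) :
    ∃ x y : 𝓗, (x, y) ∈ H.graph ∧ x + (Complex.I * c) • y = h := by
  let L : H.graph →L[ℂ] 𝓗 :=
    (ContinuousLinearMap.fst ℂ 𝓗 𝓗 + (Complex.I * c) • ContinuousLinearMap.snd ℂ 𝓗 𝓗).comp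
      H.graph.subtypeL
  have hL : ∀ p : H.graph, L p = p.1.1 + (Complex.I * c) • p.1.2 := fun p => rfl
  have hclosed : IsClosed (H.graph : Set (𝓗 × 𝓗)) := hH.isClosed
  have : CompleteSpace H.graph := hclosed.completeSpace_coe
  -- Bounded below on the complete space `H.graph`, the map `1 + i c H` has closed range; it remains
  -- to see that the range is dense.
  have hanti : AntilipschitzWith (max 1 ‖c‖₊⁻¹) L := by
    refine AddMonoidHomClass.antilipschitz_of_bound L fun p => ?_
    have hsq : ‖L p‖ ^ 2 = ‖p.1.1‖ ^ 2 + c ^ 2 * ‖p.1.2‖ ^ 2 := hH.norm_add_smul_sq p.2 c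
    have hx : ‖p.1.1‖ ≤ ‖L p‖ := by
      refine abs_le_of_sq_le_sq' ?_ (norm_nonneg _) |>.2
      rw [hsq]
      nlinarith [mul_nonneg (sq_nonneg c) (sq_nonneg ‖p.1.2‖)]
    have hy : |c| * ‖p.1.2‖ ≤ ‖L p‖ := by
      refine abs_le_of_sq_le_sq' ?_ (norm_nonneg _) |>.2
      rw [hsq, mul_pow, sq_abs]
      nlinarith [sq_nonneg ‖p.1.1‖]
    have hy' : ‖p.1.2‖ ≤ |c|⁻¹ * ‖L p‖ := by
      rw [← div_eq_inv_mul, le_div_iff₀ (abs_pos.mpr hc), mul_comm]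
      exact hy
    change ‖p.1‖ ≤ max (1 : ℝ) |c|⁻¹ * ‖L p‖
    rw [Prod.norm_def]
    refine max_le (hx.trans ?_) (hy'.trans ?_)
    · exact le_mul_of_one_le_left (norm_nonneg _) (le_max_left _ _)
    · gcongr
      exact le_max_right _ _
  have hrange : IsComplete (LinearMap.range L.toLinearMap : Set 𝓗) := by
    rw [LinearMap.coe_range]
    exact hanti.isComplete_range L.uniformContinuous
  have : CompleteSpace (LinearMap.range L.toLinearMap) := hrange.completeSpace_coe
  have hbot : (LinearMap.range L.toLinearMap)ᗮ = ⊥ := by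
    rw [Submodule.eq_bot_iff]
    intro y hy
    have hI : Complex.I * c ≠ 0 := by simp [hc]
    -- A vector orthogonal to the range would be an eigenvector of `H` with the non-real eigenvalue
    -- `(i c)⁻¹`; the norm identity with `-c` then forces it to vanish.
    have hmem : (y, (Complex.I * c)⁻¹ • y) ∈ H.graph := by
      rw [hH.mem_graph_iff_inner]
      intro a b hab
      have h0 : ⟪a + (Complex.I * c) • b, y⟫_ℂ = 0 :=
        (Submodule.mem_orthogonal _ _).mp hy _ ⟨⟨(a, b), hab⟩, rfl⟩
      rw [inner_add_left, inner_smul_left] at h0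
      rw [inner_smul_right, eq_inv_mul_iff_mul_eq₀ hI]
      simp only [map_mul, Complex.conj_I, Complex.conj_ofReal] at h0
      linear_combination -h0
    have h1 := hH.norm_add_smul_sq hmem (-c)
    have h2 : y + (Complex.I * ((-c : ℝ) : ℂ)) • (Complex.I * c)⁻¹ • y = 0 := by
      rw [smul_smul, Complex.ofReal_neg, mul_neg, neg_mul, mul_inv_cancel₀ hI]
      simp
    rw [h2, norm_zero] at h1
    have : ‖y‖ ^ 2 ≤ 0 := by
      nlinarith [mul_nonneg (sq_nonneg (-c)) (sq_nonneg ‖(Complex.I * (c : ℂ))⁻¹ • y‖)]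
    exact norm_eq_zero.mp (pow_eq_zero_iff two_ne_zero |>.mp (le_antisymm this (sq_nonneg _)))
  have htop := Submodule.orthogonal_eq_bot_iff.mp hbot
  obtain ⟨p, hp⟩ := LinearMap.range_eq_top.mp htop h
  exact ⟨p.1.1, p.1.2, p.2, hp⟩

/-- `R` is the resolvent `(1 + i c H)⁻¹`. -/
def IsResolvent (H : 𝓗 →ₗ.[ℂ] 𝓗) (c : ℝ) (R : 𝓗 →L[ℂ] 𝓗) : Prop :=
  ∀ x y : 𝓗, (x, y) ∈ H.graph → R (x + (Complex.I * c) • y) = x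

theorem IsSelfAdjoint.exists_isResolvent (hH : IsSelfAdjoint H) {c : ℝ} (hc : c ≠ 0) :
    ∃ R : 𝓗 →L[ℂ] 𝓗, IsResolvent H c R := by
  choose X Y hG hXY using hH.exists_add_smul_eq hc
  have huniq : ∀ x y : 𝓗, (x, y) ∈ H.graph → X (x + (Complex.I * c) • y) = x := by
    intro x y hxy
    set h := x + (Complex.I * c) • y with hh
    have hd : (X h - x, Y h - y) ∈ H.graph := H.graph.sub_mem (hG h) hxy
    have h1 := hH.norm_add_smul_sq hd c
    have h2 : X h - x + (Complex.I * c) • (Y h - y) = 0 := by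
      rw [smul_sub, sub_add_sub_comm, hXY, ← hh, sub_self]
    rw [h2, norm_zero] at h1
    have : ‖X h - x‖ ^ 2 ≤ 0 := by
      nlinarith [mul_nonneg (sq_nonneg c) (sq_nonneg ‖Y h - y‖)]
    exact sub_eq_zero.mp
      (norm_eq_zero.mp (pow_eq_zero_iff two_ne_zero |>.mp (le_antisymm this (sq_nonneg _))))
  let R : 𝓗 →ₗ[ℂ] 𝓗 :=
    { toFun := X
      map_add' := fun a b => by
        rw [← huniq _ _ (H.graph.add_mem (hG a) (hG b)), smul_add, add_add_add_comm, hXY, hXY]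
      map_smul' := fun r a => by
        rw [RingHom.id_apply, ← huniq _ _ (H.graph.smul_mem r (hG a)), smul_comm, ← smul_add, hXY] }
  refine ⟨R.mkContinuous 1 fun h => ?_, huniq⟩
  have h1 := hH.norm_add_smul_sq (hG h) c
  rw [hXY] at h1
  rw [one_mul]
  refine abs_le_of_sq_le_sq' ?_ (norm_nonneg _) |>.2
  change ‖X h‖ ^ 2 ≤ _
  nlinarith [mul_nonneg (sq_nonneg c) (sq_nonneg ‖Y h‖)]

namespace IsResolvent

variable {c d : ℝ} {R S : 𝓗 →L[ℂ] 𝓗}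

theorem exists_apply_mem_graph (hH : IsSelfAdjoint H) (hc : c ≠ 0) (hR : IsResolvent H c R)
    (h : 𝓗) : ∃ y, (R h, y) ∈ H.graph ∧ R h + (Complex.I * c) • y = h := by
  obtain ⟨x, y, hxy, rfl⟩ := hH.exists_add_smul_eq hc h
  exact ⟨y, by rwa [hR x y hxy], by rw [hR x y hxy]⟩

theorem norm_apply_le (hH : IsSelfAdjoint H) (hc : c ≠ 0) (hR : IsResolvent H c R) (h : 𝓗) :
    ‖R h‖ ≤ ‖h‖ := by
  obtain ⟨y, hy, hxy⟩ := hR.exists_apply_mem_graph hH hc h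
  have h1 := hH.norm_add_smul_sq hy c
  rw [hxy] at h1
  refine abs_le_of_sq_le_sq' ?_ (norm_nonneg _) |>.2
  nlinarith [mul_nonneg (sq_nonneg c) (sq_nonneg ‖y‖)]

theorem commute (hH : IsSelfAdjoint H) (hc : c ≠ 0) (hd : d ≠ 0) (hR : IsResolvent H c R)
    (hS : IsResolvent H d S) : Commute R S := by
  ext h
  change R (S h) = S (R h)
  obtain ⟨y, hy, hSy⟩ := hS.exists_apply_mem_graph hH hd h
  obtain ⟨x, hx, hRx⟩ := hR.exists_apply_mem_graph hH hc (S h)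
  have hI : Complex.I * c ≠ 0 := by simp [hc]
  have hxe : x = (Complex.I * c)⁻¹ • (S h - R (S h)) := by
    rw [eq_inv_smul_iff₀ hI, eq_sub_iff_add_eq, add_comm, hRx]
  have hx' : (x, (Complex.I * c)⁻¹ • (y - x)) ∈ H.graph := by
    have := H.graph.smul_mem (Complex.I * c)⁻¹ (H.graph.sub_mem hy hx)
    rwa [Prod.mk_sub_mk, Prod.smul_mk, ← hxe] at this
  -- With `x = H R S h`, the vector `(1 + i d H) R S h` lies in the domain and `1 + i c H` maps it
  -- to `h`, so it equals `R h`. Applying `S` then gives `S R h = R S h`.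
  have hz : (R (S h) + (Complex.I * d) • x,
      x + (Complex.I * d) • (Complex.I * c)⁻¹ • (y - x)) ∈ H.graph :=
    H.graph.add_mem hx (H.graph.smul_mem (Complex.I * d) hx')
  have hRz := hR _ _ hz
  have hsum : R (S h) + (Complex.I * d) • x + (Complex.I * c) •
      (x + (Complex.I * d) • (Complex.I * c)⁻¹ • (y - x)) = h := by
    rw [smul_add, smul_comm (Complex.I * (c : ℂ)) (Complex.I * (d : ℂ)), smul_inv_smul₀ hI,
      add_add_add_comm, hRx, ← smul_add, add_sub_cancel, hSy]
  rw [hsum] at hRz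
  rw [hRz, hS _ _ hx]

theorem inner_apply_left (hH : IsSelfAdjoint H) (hc : c ≠ 0) (hR : IsResolvent H c R)
    (hS : IsResolvent H (-c) S) (h k : 𝓗) : ⟪R h, k⟫_ℂ = ⟪h, S k⟫_ℂ := by
  obtain ⟨x, hx, hRx⟩ := hR.exists_apply_mem_graph hH hc h
  obtain ⟨y, hy, hSy⟩ := hS.exists_apply_mem_graph hH (neg_ne_zero.mpr hc) k
  have h1 := (hH.mem_graph_iff_inner _ _).mp hy _ _ hx
  conv_lhs => rw [← hSy]
  conv_rhs => rw [← hRx]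
  rw [inner_add_left, inner_add_right, inner_smul_left, inner_smul_right, h1]
  simp

end IsResolvent

theorem IsSelfAdjoint.exists_bounded_approximation (hH : IsSelfAdjoint H) :
    ∃ A : ℕ → 𝓗 →L[ℂ] 𝓗, (∀ n, IsSelfAdjoint (A n)) ∧ (∀ m n, Commute (A m) (A n)) ∧
      ∀ x y : 𝓗, (x, y) ∈ H.graph → Tendsto (fun n => A n x) atTop (𝓝 y) := by
  let c : ℕ → ℝ := fun n => 1 / ((n : ℝ) + 1)
  have hc : ∀ n, c n ≠ 0 := fun n => (Nat.one_div_pos_of_nat).ne'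
  have hc' : ∀ n, -c n ≠ 0 := fun n => neg_ne_zero.mpr (hc n)
  have hclim : Tendsto c atTop (𝓝 0) := tendsto_one_div_add_atTop_nhds_zero_nat
  choose R hR using fun n => hH.exists_isResolvent (hc n)
  choose S hS using fun n => hH.exists_isResolvent (hc' n)
  -- Resolvents tend strongly to the identity: on the domain `T f - f = -i a T (H f)`, and
  -- contractivity passes this to all vectors.
  have hlim : ∀ (a : ℕ → ℝ) (T : ℕ → 𝓗 →L[ℂ] 𝓗), (∀ n, a n ≠ 0) → Tendsto a atTop (𝓝 0) →
      (∀ n, IsResolvent H (a n) (T n)) → ∀ x, Tendsto (fun n => T n x) atTop (𝓝 x) := by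
    intro a T ha halim hT x
    rw [Metric.tendsto_atTop]
    intro ε hε
    obtain ⟨f, hf, hxf⟩ := hH.dense_domain.exists_dist_lt x (show 0 < ε / 3 by positivity)
    have hg := H.mem_graph ⟨f, hf⟩
    set g := H ⟨f, hf⟩
    have hag : Tendsto (fun n => |a n| * ‖g‖) atTop (𝓝 0) := by
      simpa using (halim.abs).mul_const ‖g‖
    obtain ⟨N, hN⟩ := (hag.eventually_lt_const (show 0 < ε / 3 by positivity)).exists_forall_of_atTop
    refine ⟨N, fun n hn => ?_⟩
    have h1 : ‖T n f - f‖ ≤ |a n| * ‖g‖ := by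
      have h2 := hT n f g hg
      rw [map_add, map_smul, ← eq_sub_iff_add_eq] at h2
      rw [h2, sub_sub_cancel_left, norm_neg, norm_smul]
      simp only [norm_mul, Complex.norm_I, one_mul, Complex.norm_real, Real.norm_eq_abs]
      gcongr
      exact (hT n).norm_apply_le hH (ha n) g
    rw [dist_eq_norm] at hxf ⊢
    have h3 : ‖T n (x - f)‖ ≤ ‖x - f‖ := (hT n).norm_apply_le hH (ha n) _
    have h4 : T n x - x = T n (x - f) + (T n f - f) - (x - f) := by
      rw [map_sub]
      abel
    rw [h4]
    have h5 := norm_sub_le (T n (x - f) + (T n f - f)) (x - f)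
    have h6 := norm_add_le (T n (x - f)) (T n f - f)
    linarith [hN n hn]
  have hRlim := hlim c R hc hclim hR
  have hSlim := hlim (fun n => -c n) S hc' (by simpa using hclim.neg) hS
  have hI : ∀ n, Complex.I * c n ≠ 0 := fun n => by simpa using hc n
  -- This is `H (1 + c² H²)⁻¹`, since `(1 - i c H)⁻¹ - (1 + i c H)⁻¹ = 2 i c H (1 + c² H²)⁻¹`. On
  -- the domain it acts as the average of the two resolvents applied to `H x`.
  refine ⟨fun n => (2 * (Complex.I * c n))⁻¹ • (S n - R n), fun n => ?_, fun m n => ?_,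
    fun x y hxy => ?_⟩
  · rw [ContinuousLinearMap.isSelfAdjoint_iff_isSymmetric]
    intro h k
    have h1 := (hR n).inner_apply_left hH (hc n) (hS n) h k
    have h2 := (hS n).inner_apply_left hH (hc' n) (by simpa using hR n) h k
    change ⟪(2 * (Complex.I * c n))⁻¹ • (S n h - R n h), k⟫_ℂ =
      ⟪h, (2 * (Complex.I * c n))⁻¹ • (S n k - R n k)⟫_ℂ
    rw [inner_smul_left, inner_smul_right, inner_sub_left, inner_sub_right, h1, h2]
    simp [map_ofNat (starRingEnd ℂ) 2]
    ring
  · refine (Commute.smul_left (Commute.smul_right ?_ _) _)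
    refine Commute.sub_left (Commute.sub_right ?_ ?_) (Commute.sub_right ?_ ?_)
    · exact (hS m).commute hH (hc' m) (hc' n) (hS n)
    · exact (hS m).commute hH (hc' m) (hc n) (hR n)
    · exact (hR m).commute hH (hc m) (hc' n) (hS n)
    · exact (hR m).commute hH (hc m) (hc n) (hR n)
  · have heq : ∀ n, ((2 * (Complex.I * c n))⁻¹ • (S n - R n)) x =
        (2 : ℂ)⁻¹ • (S n y + R n y) := by
      intro n
      have h1 := hR n x y hxy
      have h2 := hS n x y hxy
      rw [map_add, map_smul] at h1 h2
      rw [Complex.ofReal_neg, mul_neg, neg_smul] at h2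
      change (2 * (Complex.I * c n))⁻¹ • (S n x - R n x) = _
      have h3 : S n x - R n x = (Complex.I * c n) • (S n y + R n y) := by
        linear_combination (norm := module) h2 - h1
      rw [h3, smul_smul, mul_inv, mul_assoc, inv_mul_cancel₀ (hI n), mul_one]
    simp only [heq]
    have := ((hSlim y).add (hRlim y)).const_smul (2 : ℂ)⁻¹
    rwa [← two_smul ℂ y, inv_smul_smul₀ two_ne_zero] at this

end Resolvent

/-! ### Existence of the propagator -/

section Stone

open Filter Topology

variable {𝓗 : Type*} [NormedAddCommGroup 𝓗] [InnerProductSpace ℂ 𝓗] [CompleteSpace 𝓗]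
  {H : 𝓗 →ₗ.[ℂ] 𝓗}

theorem boundedPropagator.exists_tendsto {A : ℕ → 𝓗 →L[ℂ] 𝓗} (hA : ∀ n, IsSelfAdjoint (A n))
    (hcomm : ∀ m n, Commute (A m) (A n)) {D : Set 𝓗} (hD : Dense D)
    (hlim : ∀ x ∈ D, ∃ y, Tendsto (fun n => A n x) atTop (𝓝 y)) (t : ℝ) (x : 𝓗) :
    ∃ y, Tendsto (fun n => boundedPropagator (A n) t x) atTop (𝓝 y) := by
  refine cauchySeq_tendsto_of_complete ?_
  rw [Metric.cauchySeq_iff]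
  intro ε hε
  obtain ⟨f, hf, hxf⟩ := hD.exists_dist_lt x (show 0 < ε / 3 by positivity)
  obtain ⟨g, hg⟩ := hlim f hf
  obtain ⟨N, hN⟩ := Metric.cauchySeq_iff.mp hg.cauchySeq (ε / (3 * (|t| + 1))) (by positivity)
  refine ⟨N, fun m hm n hn => ?_⟩
  have h1 := norm_apply_sub_apply_le (hA m) (hA n) (hcomm m n) t f
  have h2 : |t| * ‖A m f - A n f‖ ≤ ε / 3 := by
    have h3 := (hN m hm n hn).le
    rw [dist_eq_norm] at h3
    calc |t| * ‖A m f - A n f‖ ≤ (|t| + 1) * (ε / (3 * (|t| + 1))) := by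
          gcongr
          linarith
      _ = ε / 3 := by field_simp
  have h3 := norm_apply (hA m) t (x - f)
  have h4 := norm_apply (hA n) t (x - f)
  rw [dist_eq_norm] at hxf ⊢
  have h5 : boundedPropagator (A m) t x - boundedPropagator (A n) t x =
      boundedPropagator (A m) t (x - f) + (boundedPropagator (A m) t f -
        boundedPropagator (A n) t f) - boundedPropagator (A n) t (x - f) := by
    rw [map_sub, map_sub]
    abel
  rw [h5]
  have h6 := norm_sub_le (boundedPropagator (A m) t (x - f) + (boundedPropagator (A m) t f -
    boundedPropagator (A n) t f)) (boundedPropagator (A n) t (x - f))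
  have h7 := norm_add_le (boundedPropagator (A m) t (x - f)) (boundedPropagator (A m) t f -
    boundedPropagator (A n) t f)
  linarith

/-- **Stone's theorem**, existence part. -/
theorem IsSelfAdjoint.exists_isUnitaryGroupGeneratedBy (hH : IsSelfAdjoint H) :
    ∃ U : ℝ → (𝓗 ≃ₗᵢ[ℂ] 𝓗), IsUnitaryGroupGeneratedBy H U := by
  obtain ⟨A, hA, hcomm, hlim⟩ := hH.exists_bounded_approximation
  choose u hu using boundedPropagator.exists_tendsto hA hcomm hH.dense_domain
    (fun x hx => ⟨_, hlim x _ (H.mem_graph ⟨x, hx⟩)⟩)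
  have hnorm : ∀ t x, ‖u t x‖ = ‖x‖ := fun t x =>
    tendsto_nhds_unique (hu t x).norm
      (by simp only [boundedPropagator.norm_apply (hA _)]; exact tendsto_const_nhds)
  have hadd : ∀ t x y, u t (x + y) = u t x + u t y := fun t x y =>
    tendsto_nhds_unique (hu t (x + y)) (by simpa only [map_add] using (hu t x).add (hu t y))
  have hsmul : ∀ t (r : ℂ) x, u t (r • x) = r • u t x := fun t r x =>
    tendsto_nhds_unique (hu t (r • x)) (by simpa only [map_smul] using (hu t x).const_smul r)
  have hsub : ∀ t x y, u t (x - y) = u t x - u t y := fun t x y =>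
    tendsto_nhds_unique (hu t (x - y)) (by simpa only [map_sub] using (hu t x).sub (hu t y))
  have hzero : ∀ x, u 0 x = x := fun x =>
    tendsto_nhds_unique (hu 0 x)
      (by simp only [boundedPropagator.zero_apply]; exact tendsto_const_nhds)
  have hgroup : ∀ s t x, u (s + t) x = u s (u t x) := by
    intro s t x
    refine tendsto_nhds_unique (hu (s + t) x) ?_
    have h1 : Tendsto (fun n => boundedPropagator (A n) s (boundedPropagator (A n) t x - u t x))
        atTop (𝓝 0) := by
      rw [tendsto_zero_iff_norm_tendsto_zero]
      simp only [boundedPropagator.norm_apply (hA _)]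
      exact tendsto_iff_norm_sub_tendsto_zero.mp (hu t x)
    have h2 := h1.add (hu s (u t x))
    rw [zero_add] at h2
    refine h2.congr fun n => ?_
    rw [boundedPropagator.add_apply, map_sub, sub_add_cancel]
  let U : ℝ → (𝓗 ≃ₗᵢ[ℂ] 𝓗) := fun t =>
    LinearIsometryEquiv.ofSurjective
      { toFun := u t
        map_add' := hadd t
        map_smul' := hsmul t
        norm_map' := hnorm t }
      (fun x => ⟨u (-t) x, by
        change u t (u (-t) x) = x
        rw [← hgroup, add_neg_cancel, hzero]⟩)
  have hbound : ∀ t x y, (x, y) ∈ H.graph → ‖u t x - x‖ ≤ |t| * ‖y‖ := fun t x y hxy =>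
    le_of_tendsto_of_tendsto' ((hu t x).sub_const x).norm ((hlim x y hxy).norm.const_mul |t|)
      fun n => boundedPropagator.norm_apply_sub_self_le (hA n) t x
  have hcont0 : ∀ x, Tendsto (fun t => u t x) (𝓝 0) (𝓝 x) := by
    intro x
    rw [Metric.tendsto_nhds]
    intro ε hε
    obtain ⟨f, hf, hxf⟩ := hH.dense_domain.exists_dist_lt x (show 0 < ε / 3 by positivity)
    have hg := H.mem_graph ⟨f, hf⟩
    set g := H ⟨f, hf⟩
    have hag : Tendsto (fun t : ℝ => |t| * ‖g‖) (𝓝 0) (𝓝 0) := by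
      simpa using (continuous_abs.tendsto (0 : ℝ)).mul_const ‖g‖
    filter_upwards [hag.eventually_lt_const (show 0 < ε / 3 by positivity)] with t ht
    rw [dist_eq_norm] at hxf ⊢
    have h1 := hbound t f g hg
    have h2 := hnorm t (x - f)
    have h3 : u t x - x = u t (x - f) + (u t f - f) - (x - f) := by
      rw [hsub]
      abel
    rw [h3]
    have h4 := norm_sub_le (u t (x - f) + (u t f - f)) (x - f)
    have h5 := norm_add_le (u t (x - f)) (u t f - f)
    linarith
  have hderiv : ∀ x y, (x, y) ∈ H.graph →
      HasDerivAt (fun t => u t x) (-(Complex.I • y)) 0 := by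
    intro x y hxy
    rw [hasDerivAt_iff_isLittleO, Asymptotics.isLittleO_iff]
    intro ε hε
    -- The Taylor remainder must be small uniformly in `n`. Replacing `y` by `k` in the domain gives
    -- `‖exp (-i A n s) k - k‖ ≤ |s| * ‖A n k‖`, and `‖A n k‖` converges.
    obtain ⟨k, hk, hyk⟩ := hH.dense_domain.exists_dist_lt y (show 0 < ε / 4 by positivity)
    have hg := H.mem_graph ⟨k, hk⟩
    set g := H ⟨k, hk⟩
    have hag : Tendsto (fun t : ℝ => |t| * ‖g‖) (𝓝 0) (𝓝 0) := by
      simpa using (continuous_abs.tendsto (0 : ℝ)).mul_const ‖g‖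
    filter_upwards [hag.eventually_lt_const (show 0 < ε / 4 by positivity)] with t ht
    rw [dist_eq_norm] at hyk
    have hlhs : u t x - u 0 x - (t - 0) • -(Complex.I • y) = u t x - x + t • (Complex.I • y) := by
      rw [hzero, sub_zero, smul_neg, sub_neg_eq_add]
    rw [hlhs, sub_zero, Real.norm_eq_abs]
    have hAx := hlim x y hxy
    have hdiff : Tendsto (fun n => ‖A n x - y‖) atTop (𝓝 0) :=
      tendsto_iff_norm_sub_tendsto_zero.mp hAx
    have hL : Tendsto (fun n => ‖boundedPropagator (A n) t x - x + t • (Complex.I • A n x)‖) atTop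
        (𝓝 ‖u t x - x + t • (Complex.I • y)‖) :=
      (((hu t x).sub_const x).add ((hAx.const_smul Complex.I).const_smul t)).norm
    have hR : Tendsto
        (fun n => (2 * ‖A n x - y‖ + 2 * (ε / 4) + |t| * ‖A n k‖) * |t|) atTop
        (𝓝 ((2 * 0 + 2 * (ε / 4) + |t| * ‖g‖) * |t|)) :=
      (((hdiff.const_mul 2).add_const _).add ((hlim k g hg).norm.const_mul |t|)).mul_const _
    refine (le_of_tendsto_of_tendsto' hL hR fun n => ?_).trans ?_
    · refine boundedPropagator.norm_apply_sub_self_add_le (A n) t x fun s hs => ?_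
      have h1 : boundedPropagator (A n) s (A n x) - A n x =
          boundedPropagator (A n) s (A n x - k) + (boundedPropagator (A n) s k - k)
            - (A n x - k) := by
        rw [map_sub]
        abel
      have h2 := norm_sub_le (boundedPropagator (A n) s (A n x - k) +
        (boundedPropagator (A n) s k - k)) (A n x - k)
      have h3 := norm_add_le (boundedPropagator (A n) s (A n x - k))
        (boundedPropagator (A n) s k - k)
      have h4 := boundedPropagator.norm_apply (hA n) s (A n x - k)
      have h5 := boundedPropagator.norm_apply_sub_self_le (hA n) s k
      have h6 : |s| * ‖A n k‖ ≤ |t| * ‖A n k‖ := by gcongr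
      have h7 : ‖A n x - k‖ ≤ ‖A n x - y‖ + ‖y - k‖ := norm_sub_le_norm_sub_add_norm_sub _ _ _
      rw [h1]
      linarith
    · gcongr
      linarith
  refine ⟨U, hgroup, fun x => ?_, fun x y => ⟨hderiv x y, fun hxy => ?_⟩⟩
  · change Continuous fun t => u t x
    rw [continuous_iff_continuousAt]
    intro t
    have h1 : Tendsto (fun s => s - t) (𝓝 t) (𝓝 0) := by
      simpa using (continuous_id.sub continuous_const).tendsto (f := fun s : ℝ => s - t) t
    have h2 := (hcont0 (u t x)).comp h1
    refine h2.congr fun s => ?_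
    rw [Function.comp_apply, ← hgroup, sub_add_cancel]
  · change HasDerivAt (fun t => u t x) (-(Complex.I • y)) 0 at hxy
    -- The generator is no larger than `H`: differentiating the constant `⟪U t a, U t x⟫` at `0`
    -- shows that `(x, y)` satisfies the adjoint relation, and `H` equals its adjoint.
    rw [hH.mem_graph_iff_inner]
    intro a b hab
    have h1 := (hderiv a b hab).inner ℂ hxy
    have h2 : (fun t => ⟪u t a, u t x⟫_ℂ) = fun _ => ⟪a, x⟫_ℂ :=
      funext fun t => (U t).inner_map_map a x
    rw [h2, hzero, hzero] at h1
    have h3 := h1.unique (hasDerivAt_const 0 _)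
    rw [inner_neg_right, inner_neg_left, inner_smul_left, inner_smul_right, Complex.conj_I] at h3
    have h4 : Complex.I * ⟪b, x⟫_ℂ = Complex.I * ⟪a, y⟫_ℂ := by linear_combination h3
    exact mul_left_cancel₀ Complex.I_ne_zero h4

theorem IsSelfAdjoint.isUnitaryGroupGeneratedBy_unitaryGroup (hH : IsSelfAdjoint H) :
    IsUnitaryGroupGeneratedBy H (unitaryGroup H) :=
  Classical.epsilon_spec hH.exists_isUnitaryGroupGeneratedBy

end Stone

/-! ### A comparison principle for angles -/

/-- Formally `c = cos φ` with `|φ'| ≤ W`. Since `√(1 - c²)` is not Lipschitz at `c = 1`, where the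
motion starts, `c` is compared with the strict barrier `cos ((W + ε) s + ε)` and `ε` is sent to `0`.
The phase `ε` keeps the sine positive at `s = 0`, and the extra speed `ε` makes the derivative
inequality strict at contact. -/
theorem Real.cos_mul_le_of_abs_deriv_le {W : ℝ} (hW : 0 ≤ W) {c c' : ℝ → ℝ}
    (hc : ∀ s, HasDerivAt c (c' s) s) (hc0 : c 0 = 1)
    (hbound : ∀ s, |c' s| ≤ W * √(1 - c s ^ 2)) {t : ℝ} (ht : 0 ≤ t) (htπ : W * t < Real.pi) :
    Real.cos (W * t) ≤ c t := by
  have hlim : Filter.Tendsto (fun ε : ℝ => (W + ε) * t + ε) (nhdsWithin 0 (Set.Ioi 0))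
      (nhds (W * t)) := by
    have : Continuous fun ε : ℝ => (W + ε) * t + ε := by fun_prop
    simpa using (this.tendsto 0).mono_left nhdsWithin_le_nhds
  refine le_of_tendsto ((Real.continuous_cos.tendsto _).comp hlim) ?_
  filter_upwards [hlim.eventually_lt_const htπ, self_mem_nhdsWithin] with ε hε hε0
  have hε0 : 0 < ε := hε0
  have hsin : ∀ x ∈ Set.Ico 0 t, 0 < Real.sin ((W + ε) * x + ε) := by
    intro x hx
    refine Real.sin_pos_of_pos_of_lt_pi ?_ (lt_of_le_of_lt ?_ hε)
    · have := mul_nonneg (add_nonneg hW hε0.le) hx.1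
      linarith
    · have := mul_le_mul_of_nonneg_left hx.2.le (add_nonneg hW hε0.le)
      linarith
  have hB : ∀ x, HasDerivAt (fun x => -Real.cos ((W + ε) * x + ε))
      (Real.sin ((W + ε) * x + ε) * (W + ε)) x := by
    intro x
    have h1 : HasDerivAt (fun x => (W + ε) * x + ε) (W + ε) x := by
      simpa using ((hasDerivAt_id x).const_mul (W + ε)).add_const ε
    have h2 := h1.cos.neg
    rwa [neg_mul, neg_neg] at h2
  have key := image_le_of_deriv_right_lt_deriv_boundary (f := fun x => -c x)
    (f' := fun x => -c' x) (a := 0) (b := t)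
    (fun x _ => (hc x).neg.continuousAt.continuousWithinAt)
    (fun x _ => (hc x).neg.hasDerivWithinAt)
    (by simpa [hc0] using Real.cos_le_one ε) hB
    (fun x hx heq => by
      have h1 := hbound x
      rw [neg_injective heq, ← Real.sin_sq,
        Real.sqrt_sq (hsin x hx).le] at h1
      have h2 := neg_le_abs (c' x)
      nlinarith [mul_pos hε0 (hsin x hx)])
    (Set.right_mem_Icc.mpr ht)
  exact neg_le_neg_iff.mp key

/-! ### The off-diagonal block of the generator -/

section Commutator

variable {𝓗 : Type*} [NormedAddCommGroup 𝓗] [InnerProductSpace ℂ 𝓗] {H : 𝓗 →ₗ.[ℂ] 𝓗}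

theorem norm_sub_le_commutatorNorm {P : 𝓗 →L[ℂ] 𝓗} (hV : commutatorNorm H P < ∞) {f g k : 𝓗}
    (hfg : (f, g) ∈ H.graph) (hfk : (P f, k) ∈ H.graph) :
    ‖k - P g‖ ≤ (commutatorNorm H P).toReal * ‖f‖ := by
  have hunit : ∀ {f g k : 𝓗}, (f, g) ∈ H.graph → (P f, k) ∈ H.graph → ‖f‖ = 1 →
      ‖k - P g‖ ≤ (commutatorNorm H P).toReal := by
    intro f g k hfg hfk hf
    obtain ⟨f', rfl, hg⟩ := (LinearPMap.mem_graph_iff H).mp hfg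
    obtain ⟨p, hp, hk⟩ := (LinearPMap.mem_graph_iff H).mp hfk
    dsimp only at hg hp hk
    have hmem : P (f' : 𝓗) ∈ H.domain := hp ▸ p.2
    have hpe : p = ⟨P (f' : 𝓗), hmem⟩ := Subtype.ext hp
    have h1 : ‖k - P g‖ₑ ≤ commutatorNorm H P := by
      rw [← hg, ← hk, hpe]
      exact le_iSup_of_le f' (le_iSup_of_le hmem (le_iSup_of_le hf le_rfl))
    have h2 := ENNReal.toReal_mono hV.ne h1
    rwa [toReal_enorm] at h2
  rcases eq_or_ne f 0 with rfl | hf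
  · have hg : g = 0 := H.graph_fst_eq_zero_snd hfg rfl
    have hk : k = 0 := H.graph_fst_eq_zero_snd hfk (map_zero P)
    simp [hg, hk]
  · have hpos : 0 < ‖f‖ := norm_pos_iff.mpr hf
    have h1 : ((‖f‖ : ℂ)⁻¹ • f, (‖f‖ : ℂ)⁻¹ • g) ∈ H.graph := H.graph.smul_mem _ hfg
    have h2 : (P ((‖f‖ : ℂ)⁻¹ • f), (‖f‖ : ℂ)⁻¹ • k) ∈ H.graph := by
      rw [map_smul]
      exact H.graph.smul_mem _ hfk
    have h3 := hunit h1 h2 (by simp [norm_smul, hpos.ne'])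
    rw [map_smul, ← smul_sub, norm_smul, norm_inv, Complex.norm_real, norm_norm,
      inv_mul_le_iff₀ hpos, mul_comm] at h3
    exact h3

/-- The left side is half the rate of change of `‖P (U s f)‖²` at `s = 0`. The part `⟪P f, H P f⟫`
is real and drops out after multiplication by `-i`. On `f - P f`, which `P` annihilates, the
commutator reduces to `-P H`, so its norm bounds the remaining part. -/
theorem abs_re_inner_starProjection_le [CompleteSpace 𝓗] (hH : IsSelfAdjoint H)
    {K : Submodule ℂ 𝓗} [K.HasOrthogonalProjection]
    (hdom : ∀ f ∈ H.domain, K.starProjection f ∈ H.domain)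
    (hV : commutatorNorm H K.starProjection < ∞) {f g : 𝓗} (hfg : (f, g) ∈ H.graph) :
    |(⟪K.starProjection f, -(Complex.I • g)⟫_ℂ).re| ≤
      (commutatorNorm H K.starProjection).toReal * ‖f - K.starProjection f‖ *
        ‖K.starProjection f‖ := by
  have hPP : ∀ x, K.starProjection (K.starProjection x) = K.starProjection x := fun x =>
    Submodule.starProjection_eq_self_iff.mpr (Submodule.starProjection_apply_mem K x)
  have hk := H.mem_graph ⟨_, hdom f (H.mem_domain_of_mem_graph hfg)⟩
  set k := H ⟨_, hdom f (H.mem_domain_of_mem_graph hfg)⟩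
  have hd : (f - K.starProjection f, g - k) ∈ H.graph := H.graph.sub_mem hfg hk
  have h0 : (K.starProjection (f - K.starProjection f), (0 : 𝓗)) ∈ H.graph := by
    rw [map_sub, hPP, sub_self]
    exact H.graph.zero_mem
  have h1 := norm_sub_le_commutatorNorm hV hd h0
  rw [zero_sub, norm_neg] at h1
  have him : (⟪K.starProjection f, k⟫_ℂ).im = 0 := by
    have h2 := (hH.mem_graph_iff_inner _ _).mp hk _ _ hk
    rw [← inner_conj_symm] at h2
    exact Complex.conj_eq_iff_im.mp h2
  have hsymm : ⟪K.starProjection f, g - k⟫_ℂ =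
      ⟪K.starProjection f, K.starProjection (g - k)⟫_ℂ := by
    rw [← Submodule.inner_starProjection_left_eq_right, hPP]
  have hre : (⟪K.starProjection f, -(Complex.I • g)⟫_ℂ).re =
      (⟪K.starProjection f, K.starProjection (g - k)⟫_ℂ).im := by
    rw [← hsymm, inner_sub_right, Complex.sub_im, him, inner_neg_right, inner_smul_right]
    simp
  rw [hre]
  refine (Complex.abs_im_le_norm _).trans ((norm_inner_le_norm _ _).trans ?_)
  rw [mul_comm]
  gcongr

end Commutator

/-! ### Rotation of the subspace along the flow -/

namespace IsUnitaryGroupGeneratedBy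

variable {𝓗 : Type*} [NormedAddCommGroup 𝓗] [InnerProductSpace ℂ 𝓗] {H : 𝓗 →ₗ.[ℂ] 𝓗}
  {U : ℝ → (𝓗 ≃ₗᵢ[ℂ] 𝓗)}

theorem zero_apply (hU : IsUnitaryGroupGeneratedBy H U) (f : 𝓗) : U 0 f = f :=
  (U 0).injective (by rw [← hU.map_add, add_zero])

theorem neg_eq_symm (hU : IsUnitaryGroupGeneratedBy H U) (t : ℝ) : U (-t) = (U t).symm := by
  ext f
  rw [LinearIsometryEquiv.eq_symm_apply, ← hU.map_add, add_neg_cancel, hU.zero_apply]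

theorem apply_mem_graph (hU : IsUnitaryGroupGeneratedBy H U) {f g : 𝓗} (hfg : (f, g) ∈ H.graph)
    (t : ℝ) : (U t f, U t g) ∈ H.graph := by
  rw [hU.mem_graph_iff] at hfg ⊢
  have h1 := (((U t).toContinuousLinearEquiv : 𝓗 →L[ℂ] 𝓗).restrictScalars
    ℝ).hasFDerivAt.comp_hasDerivAt 0 hfg
  have h2 : (fun s => U s (U t f)) = fun s => U t (U s f) := by
    funext s
    rw [← hU.map_add, ← hU.map_add, add_comm]
  rw [h2]
  simpa [Function.comp_def] using h1

theorem hasDerivAt (hU : IsUnitaryGroupGeneratedBy H U) {f g : 𝓗} (hfg : (f, g) ∈ H.graph)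
    (t : ℝ) : HasDerivAt (fun s => U s f) (-(Complex.I • U t g)) t := by
  have h1 := (hU.mem_graph_iff _ _).mp (hU.apply_mem_graph hfg t)
  rw [← sub_self t] at h1
  have h2 := h1.comp_sub_const t t
  simpa [← hU.map_add] using h2

variable [CompleteSpace 𝓗] {K : Submodule ℂ 𝓗} [K.HasOrthogonalProjection]

theorem norm_sub_starProjection_le_sin (hU : IsUnitaryGroupGeneratedBy H U)
    (hH : IsSelfAdjoint H) (hdom : ∀ f ∈ H.domain, K.starProjection f ∈ H.domain)
    (hV : commutatorNorm H K.starProjection < ∞) {t : ℝ}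
    (ht : (commutatorNorm H K.starProjection).toReal * |t| < Real.pi / 2) (f : 𝓗) :
    ‖U t (K.starProjection f) - K.starProjection (U t (K.starProjection f))‖ ≤
      Real.sin ((commutatorNorm H K.starProjection).toReal * |t|) * ‖K.starProjection f‖ := by
  set V := (commutatorNorm H K.starProjection).toReal with hVdef
  have hV0 : 0 ≤ V := ENNReal.toReal_nonneg
  have hsin : 0 ≤ Real.sin (V * |t|) :=
    Real.sin_nonneg_of_nonneg_of_le_pi (by positivity) (by linarith [Real.pi_pos])
  have hpyth : ∀ x : 𝓗, ‖x‖ ^ 2 = ‖K.starProjection x‖ ^ 2 + ‖x - K.starProjection x‖ ^ 2 := by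
    intro x
    rw [K.norm_sq_eq_add_norm_sq_starProjection x, Submodule.starProjection_orthogonal_val]
  have hunit : ∀ f ∈ H.domain, f ∈ K → ‖f‖ = 1 →
      ‖U t f - K.starProjection (U t f)‖ ≤ Real.sin (V * |t|) := by
    intro f hf hfK hf1
    have hg := H.mem_graph ⟨f, hf⟩
    set g := H ⟨f, hf⟩
    -- With `‖P (U s f)‖ = cos φ`, this function is `cos (2 φ)`, so the comparison principle applies
    -- with `W = 2 V`, and `W * |t| < π` is exactly `V * |t| < π / 2`.
    have hcderiv : ∀ s, HasDerivAt (fun s => 2 * ‖K.starProjection (U s f)‖ ^ 2 - 1)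
        (2 * (2 * (⟪K.starProjection (U s f), -(Complex.I • U s g)⟫_ℂ).re)) s := by
      intro s
      have h1 := (K.starProjection.restrictScalars ℝ).hasFDerivAt.comp_hasDerivAt s
        (hU.hasDerivAt hg s)
      let _ : InnerProductSpace ℝ 𝓗 := InnerProductSpace.rclikeToReal ℂ 𝓗
      have h2 := ((h1.norm_sq).const_mul 2).sub_const 1
      have h3 : (⟪K.starProjection (U s f), -(Complex.I • U s g)⟫_ℂ).re =
          ⟪K.starProjection (U s f), K.starProjection (-(Complex.I • U s g))⟫_ℝ := by
        change _ = (⟪K.starProjection (U s f), K.starProjection (-(Complex.I • U s g))⟫_ℂ).re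
        rw [← Submodule.inner_starProjection_left_eq_right, Submodule.starProjection_eq_self_iff.mpr
          (Submodule.starProjection_apply_mem K _)]
      rw [h3]
      exact h2
    have hbound : ∀ s, |2 * (2 * (⟪K.starProjection (U s f), -(Complex.I • U s g)⟫_ℂ).re)| ≤
        2 * V * √(1 - (2 * ‖K.starProjection (U s f)‖ ^ 2 - 1) ^ 2) := by
      intro s
      have h1 := abs_re_inner_starProjection_le hH hdom hV (hU.apply_mem_graph hg s)
      rw [← hVdef] at h1
      have h2 := hpyth (U s f)
      rw [LinearIsometryEquiv.norm_map, hf1] at h2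
      have h3 : √(1 - (2 * ‖K.starProjection (U s f)‖ ^ 2 - 1) ^ 2) =
          2 * (‖U s f - K.starProjection (U s f)‖ * ‖K.starProjection (U s f)‖) := by
        rw [← Real.sqrt_sq (mul_nonneg zero_le_two
          (mul_nonneg (norm_nonneg (U s f - K.starProjection (U s f)))
            (norm_nonneg (K.starProjection (U s f)))))]
        congr 1
        linear_combination (4 * ‖K.starProjection (U s f)‖ ^ 2) * h2
      rw [h3, abs_mul, abs_mul, abs_two]
      linarith
    have hc0 : 2 * ‖K.starProjection (U 0 f)‖ ^ 2 - 1 = 1 := by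
      rw [hU.zero_apply, Submodule.starProjection_eq_self_iff.mpr hfK, hf1]
      norm_num
    have hcos : Real.cos (2 * V * |t|) ≤ 2 * ‖K.starProjection (U t f)‖ ^ 2 - 1 := by
      rcases abs_cases t with ⟨h, h'⟩ | ⟨h, h'⟩
      · rw [h] at ht ⊢
        exact Real.cos_mul_le_of_abs_deriv_le (by positivity) hcderiv hc0 hbound h'
          (by linarith)
      · rw [h] at ht ⊢
        have h1 := Real.cos_mul_le_of_abs_deriv_le (W := 2 * V) (by positivity)
          (c := fun s => 2 * ‖K.starProjection (U (-s) f)‖ ^ 2 - 1)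
          (fun s => (hcderiv (-s)).comp s (hasDerivAt_neg s)) (by simpa using hc0)
          (fun s => by simpa only [mul_neg_one, abs_neg] using hbound (-s))
          (t := -t) (by linarith) (by linarith)
        simpa only [neg_neg] using h1
    have h2 := hpyth (U t f)
    rw [LinearIsometryEquiv.norm_map, hf1] at h2
    rw [mul_assoc, Real.cos_two_mul, Real.cos_sq'] at hcos
    refine abs_le_of_sq_le_sq' ?_ hsin |>.2
    linarith
  -- The set is closed, so it suffices to take `f` in the dense domain, where `P f` lies in `K ∩ Dom
  -- H`.
  have hcont : IsClosed {f : 𝓗 | ‖U t (K.starProjection f) -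
      K.starProjection (U t (K.starProjection f))‖ ≤ Real.sin (V * |t|) * ‖K.starProjection f‖} :=
    isClosed_le (by fun_prop) (by fun_prop)
  refine hcont.closure_subset_iff.mpr (fun f hf => ?_) (hH.dense_domain f)
  rw [Set.mem_ofPred_eq]
  have hPD := hdom f hf
  have hPK := Submodule.starProjection_apply_mem K f
  generalize K.starProjection f = p at hPD hPK
  rcases eq_or_ne p 0 with rfl | hp
  · simp
  · have hpos : 0 < ‖p‖ := norm_pos_iff.mpr hp
    have h3 := hunit ((‖p‖ : ℂ)⁻¹ • p) (H.domain.smul_mem _ hPD) (K.smul_mem _ hPK)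
      (by simp [norm_smul, hpos.ne'])
    rw [map_smul, map_smul, ← smul_sub, norm_smul, norm_inv, Complex.norm_real, norm_norm,
      inv_mul_le_iff₀ hpos, mul_comm] at h3
    exact h3

end IsUnitaryGroupGeneratedBy

/-! ### From one-sided bounds to the maximal angle -/

/-- With `Q = U P U⁻¹`, one has `P - Q = P (1 - Q) - (1 - P) Q`, where the two terms have orthogonal
ranges and see orthogonal parts of the argument. Both bounds are needed: if `U` maps `K` onto a
proper subspace of itself, `h` holds with `s = 0` although `‖P - Q‖ = 1`. -/
theorem norm_starProjection_sub_map_le {𝓗 : Type*} [NormedAddCommGroup 𝓗] [InnerProductSpace ℂ 𝓗]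
    {K : Submodule ℂ 𝓗} [K.HasOrthogonalProjection] (U : 𝓗 ≃ₗᵢ[ℂ] 𝓗) {s : ℝ} (hs : 0 ≤ s)
    (h : ∀ f, ‖U (K.starProjection f) - K.starProjection (U (K.starProjection f))‖ ≤
      s * ‖K.starProjection f‖)
    (h' : ∀ f, ‖U.symm (K.starProjection f) - K.starProjection (U.symm (K.starProjection f))‖ ≤
      s * ‖K.starProjection f‖) :
    ‖K.starProjection - (K.map (U.toLinearEquiv : 𝓗 →ₗ[ℂ] 𝓗)).starProjection‖ ≤ s := by
  have hPP : ∀ x, K.starProjection (K.starProjection x) = K.starProjection x := fun x =>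
    Submodule.starProjection_eq_self_iff.mpr (Submodule.starProjection_apply_mem K x)
  have hadj : ∀ x y : 𝓗, ⟪K.starProjection x, y⟫_ℂ = ⟪x, K.starProjection y⟫_ℂ :=
    Submodule.inner_starProjection_left_eq_right K
  refine ContinuousLinearMap.opNorm_le_bound _ hs fun x => ?_
  have hQ : (K.map (U.toLinearEquiv : 𝓗 →ₗ[ℂ] 𝓗)).starProjection x =
      U (K.starProjection (U.symm x)) := Submodule.starProjection_map_apply U K x
  rw [sub_apply, hQ]
  obtain ⟨y, rfl⟩ := U.surjective x
  rw [U.symm_apply_apply]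
  set q := U (K.starProjection y) with hq
  set z := U y - q with hz
  have hzU : z = U (y - K.starProjection y) := by rw [hz, map_sub]
  -- The bound on `P (1 - Q)` is by duality one on `(1 - Q) P = U (1 - P) U⁻¹ P`, which is `h'`.
  have hPz : ‖K.starProjection z‖ ≤ s * ‖z‖ := by
    rcases eq_or_ne (K.starProjection z) 0 with h0 | h0
    · rw [h0, norm_zero]
      positivity
    · refine le_of_mul_le_mul_left ?_ (norm_pos_iff.mpr h0)
      have h1 : ((‖K.starProjection z‖ * ‖K.starProjection z‖ : ℝ) : ℂ) =
          ⟪U.symm (K.starProjection z) - K.starProjection (U.symm (K.starProjection z)),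
            y - K.starProjection y⟫_ℂ := by
        have h2 : ⟪K.starProjection z, K.starProjection z⟫_ℂ =
            ⟪U.symm (K.starProjection z), y - K.starProjection y⟫_ℂ := by
          rw [← hadj, hPP]
          conv_lhs => rw [hzU, ← U.apply_symm_apply (K.starProjection (U (y - K.starProjection y))),
            U.inner_map_map]
          rw [← hzU]
        have h3 : K.starProjection (y - K.starProjection y) = 0 := by
          rw [map_sub, hPP, sub_self]
        rw [inner_sub_left, hadj _ (y - K.starProjection y), h3, inner_zero_right,
          sub_zero, ← h2, inner_self_eq_norm_sq_to_K]
        push_cast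
        exact (sq _).symm
      have h2 := congrArg norm h1
      rw [Complex.norm_real, Real.norm_of_nonneg (by positivity)] at h2
      rw [h2]
      refine (norm_inner_le_norm _ _).trans ?_
      have h3 : ‖z‖ = ‖y - K.starProjection y‖ := by rw [hzU, U.norm_map]
      rw [h3]
      calc _ ≤ s * ‖K.starProjection z‖ * ‖y - K.starProjection y‖ := by
            gcongr
            exact h' z
        _ = _ := by ring
  have hqs : ‖q - K.starProjection q‖ ≤ s * ‖q‖ := by
    rw [hq, U.norm_map]
    exact h y
  have hdec : K.starProjection (U y) - q = K.starProjection z - (q - K.starProjection q) := by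
    rw [hz, map_sub]
    abel
  have horth : ⟪K.starProjection z, q - K.starProjection q⟫_ℂ = 0 := by
    rw [hadj, map_sub, hPP, sub_self, inner_zero_right]
  have horth' : ⟪q, z⟫_ℂ = 0 := by
    rw [hq, hzU, U.inner_map_map, hadj, map_sub, hPP, sub_self, inner_zero_right]
  have h1 : ‖K.starProjection (U y) - q‖ ^ 2 =
      ‖K.starProjection z‖ ^ 2 + ‖q - K.starProjection q‖ ^ 2 := by
    rw [hdec, norm_sub_sq (𝕜 := ℂ), horth]
    simp
  have h2 : ‖U y‖ ^ 2 = ‖q‖ ^ 2 + ‖z‖ ^ 2 := by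
    rw [← add_sub_cancel q (U y), ← hz, norm_add_sq (𝕜 := ℂ), horth']
    simp
  refine abs_le_of_sq_le_sq' ?_ (by positivity) |>.2
  rw [h1, mul_pow, h2]
  have h3 := pow_le_pow_left₀ (norm_nonneg _) hPz 2
  have h4 := pow_le_pow_left₀ (norm_nonneg _) hqs 2
  rw [mul_pow] at h3 h4
  linarith

theorem maximalAngle_evolvedSubspace_le {𝓗 : Type*} [NormedAddCommGroup 𝓗]
    [InnerProductSpace ℂ 𝓗] [CompleteSpace 𝓗] {H : 𝓗 →ₗ.[ℂ] 𝓗} (hH : IsSelfAdjoint H)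
    (K : Submodule ℂ 𝓗) [K.HasOrthogonalProjection]
    (hdom : ∀ f ∈ H.domain, K.starProjection f ∈ H.domain)
    (hV : commutatorNorm H K.starProjection < ∞) (t : ℝ) :
    maximalAngle K (evolvedSubspace H K t) ≤
      (commutatorNorm H K.starProjection).toReal * |t| := by
  have hU := hH.isUnitaryGroupGeneratedBy_unitaryGroup
  rcases lt_or_ge ((commutatorNorm H K.starProjection).toReal * |t|) (Real.pi / 2) with ht | ht
  · have h0 : 0 ≤ (commutatorNorm H K.starProjection).toReal * |t| := by positivity
    refine (Real.arcsin_le_iff_le_sin' ⟨by linarith [Real.pi_pos], ht⟩).mpr ?_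
    refine norm_starProjection_sub_map_le (unitaryGroup H t)
      (Real.sin_nonneg_of_nonneg_of_le_pi h0 (by linarith [Real.pi_pos]))
      (hU.norm_sub_starProjection_le_sin hH hdom hV ht) ?_
    rw [← hU.neg_eq_symm, ← abs_neg t]
    rw [← abs_neg t] at ht
    exact hU.norm_sub_starProjection_le_sin hH hdom hV ht
  · exact (Real.arcsin_le_pi_div_two _).trans ht

theorem corollary1 {𝓗 : Type*} [NormedAddCommGroup 𝓗] [InnerProductSpace ℂ 𝓗] [CompleteSpace 𝓗]
    (H : 𝓗 →ₗ.[ℂ] 𝓗) (hH : IsSelfAdjoint H)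
    (𝔓₀ : Submodule ℂ 𝓗) [𝔓₀.HasOrthogonalProjection] (h𝔓₀ : 𝔓₀ ≠ ⊥)
    (hdom : ∀ f ∈ H.domain, 𝔓₀.starProjection f ∈ H.domain)
    (hV : commutatorNorm H 𝔓₀.starProjection < ∞)
    (θ : ℝ) (hθ : 0 < θ) (hθ' : θ ≤ Real.pi / 2) :
    (0 < commutatorNorm H 𝔓₀.starProjection →
      ∀ T : ℝ, 0 ≤ T → maximalAngle 𝔓₀ (evolvedSubspace H 𝔓₀ T) = θ →
        θ / (commutatorNorm H 𝔓₀.starProjection).toReal ≤ T) ∧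
    (commutatorNorm H 𝔓₀.starProjection = 0 →
      ∀ t : ℝ, 0 ≤ t → maximalAngle 𝔓₀ (evolvedSubspace H 𝔓₀ t) ≠ θ) := by

  have hmain := maximalAngle_evolvedSubspace_le hH 𝔓₀ hdom hV
  refine ⟨fun hpos T hT hangle => ?_, fun hzero t ht hangle => ?_⟩
  · have h1 := hmain T
    rw [hangle, abs_of_nonneg hT] at h1
    exact (div_le_iff₀' (ENNReal.toReal_pos hpos.ne' hV.ne)).mpr h1
  · have h1 := hmain t
    rw [hangle, hzero, ENNReal.toReal_zero, zero_mul] at h1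
    exact absurd h1 hθ.not_ge
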